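/- Let $A\in\mathbb{R}^{m\times n}$, $b\in\mathbb{R}^m$ with $b\neq 0$ and $\{x\in\mathbb R^n \mid Ax=b\}\neq\emptyset$, and let $\alpha>0$. Write $\|\cdot\|$ for the Euclidean norm and $A^*$ for the transpose of $A$. For $x\in\mathbb{R}^n$ let $$\Bigl(\|\cdot\|_\infty\diamond\tfrac1\alpha\|\cdot\|\Bigr)(x)=\inf_{z\in\mathbb{R}^n}\max\Bigl\{\|z\|_\infty,\ \tfrac1\alpha\|x-z\|\Bigr\},$$ and for $r>0$ let $\operatorname{prox}_{r\|\cdot\|_1}(x)=\operatorname{argmin}_{z}\{r\|z\|_1+\tfrac12\|x-z\|^2\}$. Consider the regularized basis pursuit problem $$\text{(P)}\qquad \min_{x\in\mathbb{R}^n}\ \|x\|_1+\alpha\|x\|\quad\text{subject to}\quad Ax=b,$$ and its gauge dual $$\text{(D)}\qquad \min_{y\in\mathbb{R}^m}\ \Bigl(\|\cdot\|_\infty\diamond\tfrac1\alpha\|\cdot\|\Bigr)(A^*y)\quad\text{subject to}\quad \langle b,y\rangle\ge 1.$$ Then the following hold. (i) The optimal values of (P) and (D) are finite, positive and attained, and they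 are reciprocals of each other. (ii) The objective of (D) is smooth with a locally Lipschitz gradient on the feasible set of (D): there is an open set containing the feasible set on which the objective is differentiable and its gradient is locally Lipschitz. (iii) Let $\bar y$ be an optimal solution of (D) and let $\bar r$ be its optimal value. Then $\operatorname{prox}_{\bar r\|\cdot\|_1}(A^*\bar y)$ consists of exactly one point $\bar p$, namely the soft-thresholded vector with components $\bar p_i=\operatorname{sign}\bigl((A^*\bar y)_i\bigr)\max\{|(A^*\bar y)_i|-\bar r,0\}$; moreover $\bar p\neq0$, and $$\widehat x=\frac{1/\bar r}{\|\bar p\|_1+\alpha\|\bar p\|}\,\bar p$$ is an optimal solution of (P). -/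

import Mathlib

namespace PolarBP

/-- The 1-norm on `ℝⁿ`. -/
def l1Norm {n : ℕ} (x : EuclideanSpace ℝ (Fin n)) : ℝ := ∑ i, |x i|

/-- The infinity norm on `ℝⁿ` (Mathlib's norm on `Fin n → ℝ` is the sup norm). -/
def linfNorm {n : ℕ} (x : EuclideanSpace ℝ (Fin n)) : ℝ := ‖(WithLp.ofLp x : Fin n → ℝ)‖

/-- Infimal max convolution `(f ⋄ g)(x) = inf_z max {f z, g (x - z)}`, called polar convolution
when `f` and `g` are gauges. For finite nonnegative functions, such as finite gauges, the infimum
is over a nonempty set bounded below (see `bddBelow_maxConv`), so it is a true infimum. -/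
noncomputable def maxConv {E : Type*} [AddGroup E] (f g : E → ℝ) (x : E) : ℝ :=
  ⨅ z, max (f z) (g (x - z))

theorem bddBelow_maxConv {E : Type*} [AddGroup E] (f g : E → ℝ) (hf : ∀ z, 0 ≤ f z) (x : E) :
    BddBelow (Set.range fun z => max (f z) (g (x - z))) :=
  ⟨0, by rintro _ ⟨z, rfl⟩; exact le_max_of_le_left (hf z)⟩

/-- `x` is an optimal solution of: minimize `f` over `S`. -/
def IsOptimal {E : Type*} (f : E → ℝ) (S : Set E) (x : E) : Prop := x ∈ S ∧ ∀ z ∈ S, f x ≤ f z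

/-- `v` is the optimal value of: minimize `f` over `S`, and it is attained. -/
def IsAttainedValue {E : Type*} (f : E → ℝ) (S : Set E) (v : ℝ) : Prop := IsLeast (f '' S) v

/-- The proximal map `prox_f(x)`, as the set of minimizers of `f z + (1/2) ‖x - z‖²`. -/
def prox {E : Type*} [NormedAddCommGroup E] (f : E → ℝ) (x : E) : Set E :=
  {p | ∀ z, f p + (1 / 2) * ‖x - p‖ ^ 2 ≤ f z + (1 / 2) * ‖x - z‖ ^ 2}

/-- Componentwise soft-thresholding at level `r`. -/
noncomputable def softThreshold {n : ℕ} (r : ℝ) (x : EuclideanSpace ℝ (Fin n)) :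
    EuclideanSpace ℝ (Fin n) :=
  WithLp.toLp 2 fun i => SignType.sign (x i) * max (|x i| - r) 0

/-- Feasible set `{x | A x = b}` of basis pursuit. -/
def primalFeasible {m n : ℕ} (A : Matrix (Fin m) (Fin n) ℝ) (b : EuclideanSpace ℝ (Fin m)) :
    Set (EuclideanSpace ℝ (Fin n)) :=
  {x | Matrix.toEuclideanLin A x = b}

/-- Objective `‖x‖₁ + α ‖x‖₂` of regularized basis pursuit. -/
noncomputable def primalObj {n : ℕ} (α : ℝ) (x : EuclideanSpace ℝ (Fin n)) : ℝ :=
  l1Norm x + α * ‖x‖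

/-- Feasible set `{y | ⟨b, y⟩ ≥ 1}` of the gauge dual. -/
def dualFeasible {m : ℕ} (b : EuclideanSpace ℝ (Fin m)) : Set (EuclideanSpace ℝ (Fin m)) :=
  {y | 1 ≤ inner ℝ b y}

/-- Objective `(‖·‖_∞ ⋄ (1/α) ‖·‖₂)(A* y)` of the gauge dual. -/
noncomputable def dualObj {m n : ℕ} (A : Matrix (Fin m) (Fin n) ℝ) (α : ℝ)
    (y : EuclideanSpace ℝ (Fin m)) : ℝ :=
  maxConv linfNorm (fun u => (1 / α) * ‖u‖) (Matrix.toEuclideanLin A.transpose y)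

end PolarBP

/-! Write `N u = ‖u‖₁ + α‖u‖` and let `κ` be the polar convolution. Splitting `x = z + (x - z)`
gives `⟨x, u⟩ ≤ κ x * N u`, and hence weak duality. Equality is attained by soft-thresholding: if
`p` is the threshold of `x` at a level `r` with `‖p‖ = α r`, then `⟨x, p⟩ = r * N p`, so `κ x = r`
(`polarGauge_eq_of_norm_softThreshold_eq`).

For `x ≠ 0` the normalised vector `p / N p` is thus a subgradient of `κ` at `x`. It depends on `x`
in a locally Lipschitz way, which makes it the gradient (`hasGradientAt_polarGauge`). At a dual
solution `y` with value `r`, stationarity reads `A (∇κ (A* y)) = r b`. Hence `∇κ (A* y) / r` is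
primal feasible with value `1 / r`, and weak duality makes it optimal. -/

namespace PolarBP

variable {m n : ℕ}

/-! ### Norm inequalities and the primal objective -/

section Norms

theorem l1Norm_nonneg (x : EuclideanSpace ℝ (Fin n)) : 0 ≤ l1Norm x :=
  Finset.sum_nonneg fun _ _ => abs_nonneg _

theorem linfNorm_nonneg (x : EuclideanSpace ℝ (Fin n)) : 0 ≤ linfNorm x := norm_nonneg _

theorem abs_apply_le_linfNorm (x : EuclideanSpace ℝ (Fin n)) (i : Fin n) : |x i| ≤ linfNorm x :=
  norm_le_pi_norm (WithLp.ofLp x) i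

theorem linfNorm_le {x : EuclideanSpace ℝ (Fin n)} {r : ℝ} (hr : 0 ≤ r) (h : ∀ i, |x i| ≤ r) :
    linfNorm x ≤ r :=
  (pi_norm_le_iff_of_nonneg hr).2 h

theorem abs_apply_le_norm (x : EuclideanSpace ℝ (Fin n)) (i : Fin n) : |x i| ≤ ‖x‖ :=
  PiLp.norm_apply_le x i

theorem l1Norm_le_norm (x : EuclideanSpace ℝ (Fin n)) : l1Norm x ≤ n * ‖x‖ := by
  calc l1Norm x ≤ ∑ _i : Fin n, ‖x‖ := Finset.sum_le_sum fun i _ => abs_apply_le_norm x i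
    _ = n * ‖x‖ := by simp

theorem abs_l1Norm_sub_le (x y : EuclideanSpace ℝ (Fin n)) :
    |l1Norm x - l1Norm y| ≤ l1Norm (x - y) := by
  unfold l1Norm
  rw [← Finset.sum_sub_distrib]
  refine (Finset.abs_sum_le_sum_abs _ _).trans (Finset.sum_le_sum fun i _ => ?_)
  exact abs_abs_sub_abs_le_abs_sub (x i) (y i)

theorem inner_eq_sum (x y : EuclideanSpace ℝ (Fin n)) : inner ℝ x y = ∑ i, x i * y i := by
  simp [PiLp.inner_apply, mul_comm]

theorem inner_le_linfNorm_mul_l1Norm (x u : EuclideanSpace ℝ (Fin n)) :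
    inner ℝ x u ≤ linfNorm x * l1Norm u := by
  rw [inner_eq_sum, l1Norm, Finset.mul_sum]
  refine Finset.sum_le_sum fun i _ => (le_abs_self _).trans ?_
  rw [abs_mul]
  exact mul_le_mul_of_nonneg_right (abs_apply_le_linfNorm x i) (abs_nonneg _)

theorem norm_le_l1Norm (x : EuclideanSpace ℝ (Fin n)) : ‖x‖ ≤ l1Norm x := by
  have h1 : linfNorm x ≤ ‖x‖ := linfNorm_le (norm_nonneg x) (abs_apply_le_norm x)
  have h2 := inner_le_linfNorm_mul_l1Norm x x
  rw [real_inner_self_eq_norm_sq] at h2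
  have h3 := mul_le_mul_of_nonneg_right h1 (l1Norm_nonneg x)
  rcases (norm_nonneg x).eq_or_lt with h | h
  · rw [← h]; exact l1Norm_nonneg x
  · exact le_of_mul_le_mul_left (by nlinarith) h

theorem l1Norm_smul (c : ℝ) (x : EuclideanSpace ℝ (Fin n)) : l1Norm (c • x) = |c| * l1Norm x := by
  simp [l1Norm, Finset.mul_sum, abs_mul]

variable {α : ℝ}

theorem mul_norm_le_primalObj (x : EuclideanSpace ℝ (Fin n)) : α * ‖x‖ ≤ primalObj α x :=
  le_add_of_nonneg_left (l1Norm_nonneg x)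

theorem primalObj_le (x : EuclideanSpace ℝ (Fin n)) : primalObj α x ≤ (n + α) * ‖x‖ := by
  rw [add_mul]; exact add_le_add_left (l1Norm_le_norm x) _

theorem primalObj_pos (hα : 0 < α) {x : EuclideanSpace ℝ (Fin n)} (hx : x ≠ 0) :
    0 < primalObj α x :=
  (mul_pos hα (norm_pos_iff.2 hx)).trans_le (mul_norm_le_primalObj x)

theorem primalObj_smul (c : ℝ) (x : EuclideanSpace ℝ (Fin n)) :
    primalObj α (c • x) = |c| * primalObj α x := by
  rw [primalObj, primalObj, l1Norm_smul, norm_smul, Real.norm_eq_abs]; ring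

theorem abs_primalObj_sub_le (hα : 0 < α) (x y : EuclideanSpace ℝ (Fin n)) :
    |primalObj α x - primalObj α y| ≤ (n + α) * ‖x - y‖ := by
  have h1 := (abs_l1Norm_sub_le x y).trans (l1Norm_le_norm _)
  have h2 := mul_le_mul_of_nonneg_left (abs_norm_sub_norm_le x y) hα.le
  have e : primalObj α x - primalObj α y = (l1Norm x - l1Norm y) + α * (‖x‖ - ‖y‖) := by
    unfold primalObj; ring
  rw [e]
  refine (abs_add_le _ _).trans ?_
  rw [abs_mul, abs_of_pos hα]
  linarith

end Norms

/-! ### Soft-thresholding and the proximal map -/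

section SoftThreshold

/-- Positive parts are 1-Lipschitz and piecewise linear, so this form yields joint Lipschitz bounds
in point and level. -/
theorem sign_mul_max_eq {r : ℝ} (hr : 0 ≤ r) (a : ℝ) :
    (SignType.sign a : ℝ) * max (|a| - r) 0 = max (a - r) 0 - max (-a - r) 0 := by
  rcases lt_trichotomy a 0 with h | h | h
  · rw [sign_neg h, abs_of_neg h, max_eq_right (by linarith : a - r ≤ 0)]; simp
  · subst h; simp [hr]
  · rw [sign_pos h, abs_of_pos h, max_eq_right (by linarith : -a - r ≤ 0)]; simp

theorem softThreshold_apply {r : ℝ} (hr : 0 ≤ r) (x : EuclideanSpace ℝ (Fin n)) (i : Fin n) :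
    softThreshold r x i = max (x i - r) 0 - max (-x i - r) 0 :=
  sign_mul_max_eq hr (x i)

/-- With `abs_sub_softThreshold_le`, this says that `x - p` is a subgradient of `r‖·‖₁` at the
thresholded vector `p`. -/
theorem softThreshold_mul_sub {r : ℝ} (hr : 0 ≤ r) (x : EuclideanSpace ℝ (Fin n)) (i : Fin n) :
    (x i - softThreshold r x i) * softThreshold r x i = r * |softThreshold r x i| := by
  rw [softThreshold_apply hr]
  rcases le_total (x i - r) 0 with h | h <;> rcases le_total (-x i - r) 0 with h' | h'
  · simp [h, h']
  · rw [max_eq_right h, max_eq_left h', abs_of_nonpos (by linarith)]; ring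
  · rw [max_eq_left h, max_eq_right h', abs_of_nonneg (by linarith)]; ring
  · have h0 : r = 0 := by linarith
    have h1 : x i = 0 := by linarith
    simp [h0, h1]

theorem abs_sub_softThreshold_le {r : ℝ} (hr : 0 ≤ r) (x : EuclideanSpace ℝ (Fin n)) (i : Fin n) :
    |x i - softThreshold r x i| ≤ r := by
  rw [softThreshold_apply hr, abs_le]
  constructor <;> rcases max_cases (x i - r) 0 with h | h <;>
    rcases max_cases (-x i - r) 0 with h' | h' <;> linarith

theorem abs_softThreshold_sub_le {r s : ℝ} (hr : 0 ≤ r) (hs : 0 ≤ s)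
    (x y : EuclideanSpace ℝ (Fin n)) (i : Fin n) :
    |softThreshold r x i - softThreshold s y i| ≤ 2 * (|x i - y i| + |r - s|) := by
  have key : ∀ a b : ℝ, |max a 0 - max b 0| ≤ |a - b| := fun a b => abs_max_sub_max_le_abs a b 0
  rw [softThreshold_apply hr, softThreshold_apply hs]
  have h1 : |max (x i - r) 0 - max (y i - s) 0| ≤ |x i - y i| + |r - s| := by
    refine (key _ _).trans ?_
    rw [show x i - r - (y i - s) = (x i - y i) - (r - s) by ring]
    exact abs_sub _ _
  have h2 : |max (-x i - r) 0 - max (-y i - s) 0| ≤ |x i - y i| + |r - s| := by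
    refine (key _ _).trans ?_
    rw [show -x i - r - (-y i - s) = -((x i - y i) + (r - s)) by ring, abs_neg]
    exact abs_add_le _ _
  rw [show max (x i - r) 0 - max (-x i - r) 0 - (max (y i - s) 0 - max (-y i - s) 0) =
    (max (x i - r) 0 - max (y i - s) 0) - (max (-x i - r) 0 - max (-y i - s) 0) by ring]
  exact (abs_sub _ _).trans (by linarith)

theorem norm_softThreshold_sub_le {r s : ℝ} (hr : 0 ≤ r) (hs : 0 ≤ s)
    (x y : EuclideanSpace ℝ (Fin n)) :
    ‖softThreshold r x - softThreshold s y‖ ≤ 2 * n * (‖x - y‖ + |r - s|) := by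
  refine (norm_le_l1Norm _).trans ?_
  calc l1Norm (softThreshold r x - softThreshold s y)
      ≤ ∑ _i : Fin n, 2 * (‖x - y‖ + |r - s|) := by
        refine Finset.sum_le_sum fun i _ => (abs_softThreshold_sub_le hr hs x y i).trans ?_
        have := abs_apply_le_norm (x - y) i
        rw [PiLp.sub_apply] at this
        linarith
    _ = 2 * n * (‖x - y‖ + |r - s|) := by simp; ring

theorem inner_softThreshold {r : ℝ} (hr : 0 ≤ r) (x : EuclideanSpace ℝ (Fin n)) :
    inner ℝ x (softThreshold r x) = r * l1Norm (softThreshold r x) + ‖softThreshold r x‖ ^ 2 := by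
  rw [← real_inner_self_eq_norm_sq, inner_eq_sum, inner_eq_sum, l1Norm, Finset.mul_sum,
    ← Finset.sum_add_distrib]
  refine Finset.sum_congr rfl fun i _ => ?_
  rw [← softThreshold_mul_sub hr]; ring

theorem softThreshold_zero_left (x : EuclideanSpace ℝ (Fin n)) : softThreshold 0 x = x := by
  ext i
  rw [softThreshold_apply le_rfl]
  rcases max_cases (x i - 0) 0 with h | h <;> rcases max_cases (-x i - 0) 0 with h' | h' <;>
    linarith

theorem norm_softThreshold_le {r : ℝ} (hr : 0 ≤ r) (x : EuclideanSpace ℝ (Fin n)) :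
    ‖softThreshold r x‖ ≤ ‖x‖ := by
  have h := inner_softThreshold hr x
  have h1 := real_inner_le_norm x (softThreshold r x)
  have h2 := mul_nonneg hr (l1Norm_nonneg (softThreshold r x))
  by_contra hlt
  push Not at hlt
  nlinarith [norm_nonneg x]

theorem continuous_softThreshold_left (x : EuclideanSpace ℝ (Fin n)) :
    Continuous fun r => softThreshold r x := by
  unfold softThreshold
  exact (PiLp.continuous_toLp 2 _).comp (by fun_prop)

theorem exists_norm_softThreshold_eq {α : ℝ} (hα : 0 < α) (x : EuclideanSpace ℝ (Fin n)) :
    ∃ r, 0 ≤ r ∧ ‖softThreshold r x‖ = α * r := by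
  have h0 : 0 ≤ ‖x‖ / α := by positivity
  have hc : Continuous fun r => α * r - ‖softThreshold r x‖ :=
    (continuous_const.mul continuous_id).sub (continuous_softThreshold_left x).norm
  -- Thresholding never increases the norm, so `α r` has overtaken it by `r = ‖x‖ / α`.
  have hmem : (0 : ℝ) ∈ Set.Icc (α * 0 - ‖softThreshold 0 x‖)
      (α * (‖x‖ / α) - ‖softThreshold (‖x‖ / α) x‖) := by
    constructor
    · simp
    · rw [mul_div_cancel₀ _ hα.ne']
      exact sub_nonneg.2 (norm_softThreshold_le h0 x)
  obtain ⟨r, hr, h⟩ := intermediate_value_Icc h0 hc.continuousOn hmem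
  exact ⟨r, hr.1, (sub_eq_zero.1 h).symm⟩

theorem prox_smul_l1Norm {r : ℝ} (hr : 0 ≤ r) (x : EuclideanSpace ℝ (Fin n)) :
    prox (fun z => r * l1Norm z) x = {softThreshold r x} := by
  set p := softThreshold r x with hp
  -- Strong convexity: the extra quadratic term gives uniqueness as well as minimality.
  have key : ∀ z, r * l1Norm p + (1 / 2) * ‖x - p‖ ^ 2 + (1 / 2) * ‖z - p‖ ^ 2 ≤
      r * l1Norm z + (1 / 2) * ‖x - z‖ ^ 2 := by
    intro z
    simp only [← real_inner_self_eq_norm_sq, inner_eq_sum, l1Norm, Finset.mul_sum,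
      ← Finset.sum_add_distrib]
    refine Finset.sum_le_sum fun i _ => ?_
    have h1 := softThreshold_mul_sub hr x i
    have h2 := abs_sub_softThreshold_le hr x i
    rw [← hp] at h1 h2
    have h3 : (x i - p i) * z i ≤ r * |z i| := by
      refine (le_abs_self _).trans ?_
      rw [abs_mul]
      exact mul_le_mul_of_nonneg_right h2 (abs_nonneg _)
    simp only [PiLp.sub_apply]
    nlinarith
  ext q
  simp only [prox, Set.mem_ofPred_eq, Set.mem_singleton_iff]
  constructor
  · intro hq
    have h1 := hq p
    have h2 := key q
    have h3 : ‖q - p‖ = 0 := by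
      have : ‖q - p‖ ^ 2 ≤ 0 := by linarith
      exact pow_eq_zero_iff (two_ne_zero) |>.1 (le_antisymm this (sq_nonneg _))
    exact sub_eq_zero.1 (norm_eq_zero.1 h3)
  · intro hq z
    rw [hq]
    have := key z
    have := sq_nonneg ‖z - p‖
    linarith

end SoftThreshold

/-! ### The polar gauge, its candidate gradient and Lipschitz bounds -/

section PolarGauge

/-- The polar convolution of the infinity norm and the scaled Euclidean norm. -/
noncomputable def polarGauge (α : ℝ) (x : EuclideanSpace ℝ (Fin n)) : ℝ :=
  maxConv linfNorm (fun u => (1 / α) * ‖u‖) x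

variable {α : ℝ}

theorem inner_le_polarGauge_mul (hα : 0 < α) (x u : EuclideanSpace ℝ (Fin n)) :
    inner ℝ x u ≤ polarGauge α x * primalObj α u := by
  rcases eq_or_ne u 0 with rfl | hu
  · simp [primalObj, l1Norm]
  have hN := primalObj_pos hα hu
  rw [← div_le_iff₀ hN]
  refine le_ciInf fun z => ?_
  rw [div_le_iff₀ hN]
  set M := max (linfNorm z) (1 / α * ‖x - z‖)
  have h1 : linfNorm z ≤ M := le_max_left _ _
  have h2 : ‖x - z‖ ≤ M * α := by
    have : 1 / α * ‖x - z‖ ≤ M := le_max_right _ _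
    rwa [one_div, inv_mul_le_iff₀ hα, mul_comm] at this
  calc inner ℝ x u = inner ℝ z u + inner ℝ (x - z) u := by rw [← inner_add_left]; simp
    _ ≤ linfNorm z * l1Norm u + ‖x - z‖ * ‖u‖ :=
      add_le_add (inner_le_linfNorm_mul_l1Norm z u) (real_inner_le_norm _ _)
    _ ≤ M * l1Norm u + M * α * ‖u‖ := add_le_add
      (mul_le_mul_of_nonneg_right h1 (l1Norm_nonneg u))
      (mul_le_mul_of_nonneg_right h2 (norm_nonneg u))
    _ = M * primalObj α u := by unfold primalObj; ring

theorem polarGauge_nonneg (α : ℝ) (x : EuclideanSpace ℝ (Fin n)) : 0 ≤ polarGauge α x :=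
  Real.iInf_nonneg fun _ => le_max_of_le_left (linfNorm_nonneg _)

theorem norm_le_mul_polarGauge (hα : 0 < α) (x : EuclideanSpace ℝ (Fin n)) :
    ‖x‖ ≤ (n + α) * polarGauge α x := by
  have h1 := inner_le_polarGauge_mul hα x x
  rw [real_inner_self_eq_norm_sq] at h1
  have h2 := mul_le_mul_of_nonneg_left (primalObj_le (α := α) x) (polarGauge_nonneg α x)
  rcases (norm_nonneg x).eq_or_lt with h | h
  · rw [← h]; exact mul_nonneg (by positivity) (polarGauge_nonneg α x)
  · exact le_of_mul_le_mul_left (by nlinarith) h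

theorem polarGauge_pos (hα : 0 < α) {x : EuclideanSpace ℝ (Fin n)} (hx : x ≠ 0) :
    0 < polarGauge α x := by
  have h := (norm_pos_iff.2 hx).trans_le (norm_le_mul_polarGauge hα x)
  exact pos_of_mul_pos_right h (by positivity)

/-- With `p` the thresholded vector, `z = x - p` makes both terms of the maximum at most `r`.
Conversely, pairing `x` with `p` turns the Hölder-type inequality into `r * N p ≤ κ x * N p`. -/
theorem polarGauge_eq_of_norm_softThreshold_eq (hα : 0 < α) {x : EuclideanSpace ℝ (Fin n)}
    {r : ℝ} (hr : 0 ≤ r) (h : ‖softThreshold r x‖ = α * r) : polarGauge α x = r := by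
  apply le_antisymm
  · refine le_trans (ciInf_le (bddBelow_maxConv linfNorm (fun u => (1 / α) * ‖u‖) linfNorm_nonneg x)
      (x - softThreshold r x)) ?_
    refine max_le (linfNorm_le hr fun i => abs_sub_softThreshold_le hr x i) ?_
    rw [sub_sub_cancel, h, one_div, inv_mul_cancel_left₀ hα.ne']
  · rcases hr.eq_or_lt with rfl | hr'
    · exact polarGauge_nonneg α x
    have hp : softThreshold r x ≠ 0 := norm_pos_iff.1 (by rw [h]; positivity)
    refine le_of_mul_le_mul_right ?_ (primalObj_pos hα hp)
    refine le_trans (le_of_eq ?_) (inner_le_polarGauge_mul hα x (softThreshold r x))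
    rw [inner_softThreshold hr, primalObj, h]; ring

/-- The residual of the infimum defining the polar gauge at `x`. -/
noncomputable def shrink (α : ℝ) (x : EuclideanSpace ℝ (Fin n)) : EuclideanSpace ℝ (Fin n) :=
  softThreshold (polarGauge α x) x

theorem norm_shrink (hα : 0 < α) (x : EuclideanSpace ℝ (Fin n)) :
    ‖shrink α x‖ = α * polarGauge α x := by
  obtain ⟨r, hr, h⟩ := exists_norm_softThreshold_eq hα x
  rw [shrink, polarGauge_eq_of_norm_softThreshold_eq hα hr h, h]

theorem shrink_ne_zero (hα : 0 < α) {x : EuclideanSpace ℝ (Fin n)} (hx : x ≠ 0) :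
    shrink α x ≠ 0 :=
  norm_pos_iff.1 (by rw [norm_shrink hα]; exact mul_pos hα (polarGauge_pos hα hx))

/-- The gradient of the polar gauge away from the origin. -/
noncomputable def polarGrad (α : ℝ) (x : EuclideanSpace ℝ (Fin n)) : EuclideanSpace ℝ (Fin n) :=
  (primalObj α (shrink α x))⁻¹ • shrink α x

theorem primalObj_polarGrad (hα : 0 < α) {x : EuclideanSpace ℝ (Fin n)} (hx : x ≠ 0) :
    primalObj α (polarGrad α x) = 1 := by
  have h := primalObj_pos hα (shrink_ne_zero hα hx)
  rw [polarGrad, primalObj_smul, abs_of_pos (inv_pos.2 h), inv_mul_cancel₀ h.ne']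

theorem inner_polarGrad_self (hα : 0 < α) {x : EuclideanSpace ℝ (Fin n)} (hx : x ≠ 0) :
    inner ℝ x (polarGrad α x) = polarGauge α x := by
  have h := primalObj_pos hα (shrink_ne_zero hα hx)
  have e : inner ℝ x (shrink α x) = polarGauge α x * primalObj α (shrink α x) := by
    have h1 := inner_softThreshold (polarGauge_nonneg α x) x
    rw [← shrink] at h1
    rw [h1, primalObj, pow_two]
    nth_rewrite 1 [norm_shrink hα]
    ring
  rw [polarGrad, inner_smul_right, e, mul_comm, mul_inv_cancel_right₀ h.ne']

theorem inner_polarGrad_le (hα : 0 < α) (x : EuclideanSpace ℝ (Fin n))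
    {y : EuclideanSpace ℝ (Fin n)} (hy : y ≠ 0) :
    inner ℝ x (polarGrad α y) ≤ polarGauge α x := by
  have := inner_le_polarGauge_mul hα x (polarGrad α y)
  rwa [primalObj_polarGrad hα hy, mul_one] at this

theorem norm_polarGrad_le (hα : 0 < α) {x : EuclideanSpace ℝ (Fin n)} (hx : x ≠ 0) :
    ‖polarGrad α x‖ ≤ 1 / α := by
  rw [le_div_iff₀ hα, mul_comm, ← primalObj_polarGrad hα hx]
  exact mul_norm_le_primalObj _

theorem polarGauge_zero (hα : 0 < α) : polarGauge α (0 : EuclideanSpace ℝ (Fin n)) = 0 :=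
  polarGauge_eq_of_norm_softThreshold_eq hα le_rfl (by rw [softThreshold_zero_left]; simp)

theorem polarGauge_smul_le (hα : 0 < α) {c : ℝ} (hc : 0 ≤ c) (x : EuclideanSpace ℝ (Fin n)) :
    polarGauge α (c • x) ≤ c * polarGauge α x := by
  rcases eq_or_ne (c • x) 0 with h | h
  · rw [h, polarGauge_zero hα]; exact mul_nonneg hc (polarGauge_nonneg α x)
  · rw [← inner_polarGrad_self hα h, real_inner_smul_left]
    exact mul_le_mul_of_nonneg_left (inner_polarGrad_le hα x h) hc

theorem polarGauge_sub_le (hα : 0 < α) (x y : EuclideanSpace ℝ (Fin n)) :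
    polarGauge α x - polarGauge α y ≤ 1 / α * ‖x - y‖ := by
  rcases eq_or_ne x 0 with rfl | hx
  · rw [polarGauge_zero hα]
    have := polarGauge_nonneg α y
    have : 0 ≤ 1 / α * ‖0 - y‖ := by positivity
    linarith
  · have h1 := inner_polarGrad_le hα y hx
    calc polarGauge α x - polarGauge α y ≤ inner ℝ (x - y) (polarGrad α x) := by
          rw [inner_sub_left, inner_polarGrad_self hα hx]; linarith
      _ ≤ ‖x - y‖ * ‖polarGrad α x‖ := real_inner_le_norm _ _
      _ ≤ ‖x - y‖ * (1 / α) :=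
        mul_le_mul_of_nonneg_left (norm_polarGrad_le hα hx) (norm_nonneg _)
      _ = 1 / α * ‖x - y‖ := mul_comm _ _

theorem abs_polarGauge_sub_le (hα : 0 < α) (x y : EuclideanSpace ℝ (Fin n)) :
    |polarGauge α x - polarGauge α y| ≤ 1 / α * ‖x - y‖ := by
  refine abs_sub_le_iff.2 ⟨polarGauge_sub_le hα x y, ?_⟩
  rw [norm_sub_rev]; exact polarGauge_sub_le hα y x

theorem continuous_polarGauge (hα : 0 < α) :
    Continuous (polarGauge α : EuclideanSpace ℝ (Fin n) → ℝ) := by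
  have : LipschitzWith (1 / α).toNNReal (polarGauge α : EuclideanSpace ℝ (Fin n) → ℝ) :=
    LipschitzWith.of_dist_le_mul fun x y => by
      rw [Real.dist_eq, dist_eq_norm, Real.coe_toNNReal _ (by positivity)]
      exact abs_polarGauge_sub_le hα x y
  exact this.continuous

theorem norm_shrink_sub_le (hα : 0 < α) (x y : EuclideanSpace ℝ (Fin n)) :
    ‖shrink α x - shrink α y‖ ≤ 2 * n * (1 + 1 / α) * ‖x - y‖ := by
  refine (norm_softThreshold_sub_le (polarGauge_nonneg α x) (polarGauge_nonneg α y) x y).trans ?_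
  rw [mul_assoc (2 * (n : ℝ))]
  refine mul_le_mul_of_nonneg_left ?_ (by positivity)
  rw [add_mul, one_mul]
  exact add_le_add_right (abs_polarGauge_sub_le hα x y) _

/-- The normalised `q` has norm at most `1 / α`, so only the value at `p` remains in the
denominator. -/
theorem norm_inv_primalObj_smul_sub_le (hα : 0 < α) {p q : EuclideanSpace ℝ (Fin n)} (hp : p ≠ 0)
    (hq : q ≠ 0) :
    ‖(primalObj α p)⁻¹ • p - (primalObj α q)⁻¹ • q‖ ≤
      (2 + n / α) * (primalObj α p)⁻¹ * ‖p - q‖ := by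
  have hP := primalObj_pos hα hp
  have hQ := primalObj_pos hα hq
  have e : (primalObj α p)⁻¹ • p - (primalObj α q)⁻¹ • q =
      (primalObj α p)⁻¹ • ((p - q) + (primalObj α q - primalObj α p) • (primalObj α q)⁻¹ • q) := by
    simp only [smul_add, smul_sub, smul_smul]
    have h1 : (primalObj α p)⁻¹ * ((primalObj α q - primalObj α p) * (primalObj α q)⁻¹) =
        (primalObj α p)⁻¹ - (primalObj α q)⁻¹ := by field_simp
    rw [h1, sub_smul]; abel
  have hu : ‖(primalObj α q)⁻¹ • q‖ ≤ 1 / α := by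
    rw [norm_smul, Real.norm_eq_abs, abs_of_pos (inv_pos.2 hQ), inv_mul_le_iff₀ hQ, mul_one_div,
      le_div_iff₀ hα, mul_comm]
    exact mul_norm_le_primalObj q
  have hd := abs_primalObj_sub_le hα q p
  rw [norm_sub_rev q p] at hd
  rw [e, norm_smul, Real.norm_eq_abs, abs_of_pos (inv_pos.2 hP), mul_comm (2 + (n : ℝ) / α),
    mul_assoc]
  refine mul_le_mul_of_nonneg_left ((norm_add_le _ _).trans ?_) (inv_pos.2 hP).le
  rw [norm_smul (primalObj α q - primalObj α p), Real.norm_eq_abs]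
  calc ‖p - q‖ + |primalObj α q - primalObj α p| * ‖(primalObj α q)⁻¹ • q‖
      ≤ ‖p - q‖ + (n + α) * ‖p - q‖ * (1 / α) := by gcongr
    _ = (2 + n / α) * ‖p - q‖ := by field_simp; ring

theorem exists_norm_polarGrad_sub_le (hα : 0 < α) : ∃ C : ℝ, 0 ≤ C ∧
    ∀ x y : EuclideanSpace ℝ (Fin n), x ≠ 0 → y ≠ 0 →
      ‖polarGrad α x - polarGrad α y‖ ≤ C / polarGauge α x * ‖x - y‖ := by
  refine ⟨(2 + n / α) * (1 / α ^ 2) * (2 * n * (1 + 1 / α)), by positivity, fun x y hx hy => ?_⟩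
  have hκ := polarGauge_pos hα hx
  have hN : α ^ 2 * polarGauge α x ≤ primalObj α (shrink α x) := by
    have := mul_norm_le_primalObj (α := α) (shrink α x)
    rw [norm_shrink hα] at this
    linarith
  have hinv : (primalObj α (shrink α x))⁻¹ ≤ 1 / α ^ 2 * (1 / polarGauge α x) := by
    rw [one_div_mul_one_div, one_div]
    exact inv_anti₀ (by positivity) hN
  calc ‖polarGrad α x - polarGrad α y‖
      ≤ (2 + n / α) * (primalObj α (shrink α x))⁻¹ * ‖shrink α x - shrink α y‖ :=
        norm_inv_primalObj_smul_sub_le hα (shrink_ne_zero hα hx) (shrink_ne_zero hα hy)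
    _ ≤ (2 + n / α) * (1 / α ^ 2 * (1 / polarGauge α x)) *
        (2 * n * (1 + 1 / α) * ‖x - y‖) := by
        gcongr
        exact norm_shrink_sub_le hα x y
    _ = _ := by ring

end PolarGauge

/-! ### Differentiability of the polar gauge away from the origin -/

section Gradient

variable {α : ℝ}

/-- The subgradient inequalities at `x` and at `y` squeeze `κ y - κ x` between the pairings of `y -
x` with the two subgradients. -/
theorem abs_polarGauge_sub_sub_inner_le (hα : 0 < α) {x y : EuclideanSpace ℝ (Fin n)}
    (hx : x ≠ 0) (hy : y ≠ 0) :
    |polarGauge α y - polarGauge α x - inner ℝ (polarGrad α x) (y - x)| ≤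
      ‖polarGrad α x - polarGrad α y‖ * ‖x - y‖ := by
  have h1 := inner_polarGrad_le hα y hx
  have h2 := inner_polarGrad_le hα x hy
  have h3 := inner_polarGrad_self hα hx
  have h4 := inner_polarGrad_self hα hy
  have h5 := real_inner_le_norm (polarGrad α x - polarGrad α y) (x - y)
  rw [inner_sub_left, inner_sub_right, inner_sub_right] at h5
  rw [real_inner_comm] at h1 h2 h3 h4
  rw [inner_sub_right, abs_le]
  constructor <;> linarith

theorem hasGradientAt_polarGauge (hα : 0 < α) {x : EuclideanSpace ℝ (Fin n)} (hx : x ≠ 0) :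
    HasGradientAt (polarGauge α) (polarGrad α x) x := by
  obtain ⟨C, hC, h⟩ := exists_norm_polarGrad_sub_le (n := n) hα
  rw [hasGradientAt_iff_isLittleO]
  have hO : (fun y => polarGauge α y - polarGauge α x - inner ℝ (polarGrad α x) (y - x)) =O[nhds x]
      fun y => ‖y - x‖ ^ 2 := by
    refine Asymptotics.IsBigO.of_bound (C / polarGauge α x) ?_
    filter_upwards [isOpen_ne.mem_nhds hx] with y hy
    refine (abs_polarGauge_sub_sub_inner_le hα hx hy).trans ?_
    rw [Real.norm_eq_abs, abs_of_nonneg (by positivity), norm_sub_rev y x, pow_two, ← mul_assoc]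
    exact mul_le_mul_of_nonneg_right (h x y hx hy) (norm_nonneg _)
  refine hO.trans_isLittleO ?_
  have := Asymptotics.isLittleO_norm_pow_id (E' := EuclideanSpace ℝ (Fin n)) one_lt_two
  refine (this.comp_tendsto (k := fun y => y - x) (l' := nhds x) ?_)
  exact tendsto_sub_nhds_zero_iff.2 Filter.tendsto_id

theorem locallyLipschitzOn_polarGrad (hα : 0 < α) :
    LocallyLipschitzOn {x : EuclideanSpace ℝ (Fin n) | x ≠ 0} (polarGrad α) := by
  obtain ⟨C, hC, h⟩ := exists_norm_polarGrad_sub_le (n := n) hα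
  intro x hx
  have hκ := polarGauge_pos hα hx
  refine ⟨(C / (polarGauge α x / 2)).toNNReal,
    -- Here `κ` is bounded below, so the constant `C / κ` becomes uniform.
    {y | polarGauge α x / 2 < polarGauge α y} ∩ {y | y ≠ 0}, ?_, ?_⟩
  · refine mem_nhdsWithin_of_mem_nhds (Filter.inter_mem ?_ (isOpen_ne.mem_nhds hx))
    exact (isOpen_lt continuous_const (continuous_polarGauge hα)).mem_nhds
      (half_lt_self hκ)
  · refine LipschitzOnWith.of_dist_le_mul fun y hy z hz => ?_
    rw [dist_eq_norm, dist_eq_norm, Real.coe_toNNReal _ (by positivity)]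
    refine (h y z hy.2 hz.2).trans ?_
    have : polarGauge α x / 2 < polarGauge α y := hy.1
    gcongr

end Gradient

/-! ### Gauge duality: attainment, stationarity and primal recovery -/

section GaugeDual

variable {α : ℝ} (A : Matrix (Fin m) (Fin n) ℝ)

theorem inner_toEuclideanLin (x : EuclideanSpace ℝ (Fin n)) (y : EuclideanSpace ℝ (Fin m)) :
    inner ℝ (Matrix.toEuclideanLin A x) y = inner ℝ x (Matrix.toEuclideanLin A.transpose y) := by
  rw [← Matrix.conjTranspose_eq_transpose_of_trivial,
    Matrix.toEuclideanLin_conjTranspose_eq_adjoint, LinearMap.adjoint_inner_right]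

theorem hasGradientAt_dualObj (hα : 0 < α) {y : EuclideanSpace ℝ (Fin m)}
    (hy : Matrix.toEuclideanLin A.transpose y ≠ 0) :
    HasGradientAt (dualObj A α)
      (Matrix.toEuclideanLin A (polarGrad α (Matrix.toEuclideanLin A.transpose y))) y := by
  have h := (hasGradientAt_polarGauge hα hy).hasFDerivAt.comp y
    (LinearMap.toContinuousLinearMap (Matrix.toEuclideanLin A.transpose)).hasFDerivAt
  rw [hasGradientAt_iff_hasFDerivAt]
  refine h.congr_fderiv ?_
  ext v
  simp [inner_toEuclideanLin]

theorem locallyLipschitzOn_gradient_dualObj (hα : 0 < α) :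
    LocallyLipschitzOn {y | Matrix.toEuclideanLin A.transpose y ≠ 0}
      (gradient (dualObj A α)) := by
  have h : LocallyLipschitzOn {y | Matrix.toEuclideanLin A.transpose y ≠ 0}
      (Matrix.toEuclideanLin A ∘ polarGrad α ∘ Matrix.toEuclideanLin A.transpose) := by
    intro y hy
    obtain ⟨K, t, ht, hK⟩ := locallyLipschitzOn_polarGrad hα hy
    let L := LinearMap.toContinuousLinearMap (Matrix.toEuclideanLin A.transpose)
    let M := LinearMap.toContinuousLinearMap (Matrix.toEuclideanLin A)
    refine ⟨_, L ⁻¹' t, ?_, M.lipschitz.comp_lipschitzOnWith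
      (hK.comp (L.lipschitz.lipschitzOnWith (s := L ⁻¹' t)) (Set.mapsTo_preimage _ _))⟩
    exact (L.continuous.continuousWithinAt.tendsto_nhdsWithin fun _ hz => hz) ht
  intro y hy
  obtain ⟨K, t, ht, hK⟩ := h hy
  refine ⟨K, t ∩ {y | Matrix.toEuclideanLin A.transpose y ≠ 0},
    Filter.inter_mem ht self_mem_nhdsWithin, fun u hu v hv => ?_⟩
  rw [(hasGradientAt_dualObj A hα hu.2).gradient, (hasGradientAt_dualObj A hα hv.2).gradient]
  exact hK hu.1 hv.1

variable {A} {b : EuclideanSpace ℝ (Fin m)}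

theorem transpose_ne_zero_of_mem_dualFeasible (hfeas : (primalFeasible A b).Nonempty)
    {y : EuclideanSpace ℝ (Fin m)} (hy : y ∈ dualFeasible b) :
    Matrix.toEuclideanLin A.transpose y ≠ 0 := by
  obtain ⟨x, rfl⟩ := hfeas
  intro h
  have h1 : (1 : ℝ) ≤ inner ℝ (Matrix.toEuclideanLin A x) y := hy
  rw [inner_toEuclideanLin, h, inner_zero_right] at h1
  linarith

/-- Weak gauge duality. -/
theorem one_le_dualObj_mul_primalObj (hα : 0 < α) {x : EuclideanSpace ℝ (Fin n)}
    {y : EuclideanSpace ℝ (Fin m)} (hx : x ∈ primalFeasible A b) (hy : y ∈ dualFeasible b) :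
    1 ≤ dualObj A α y * primalObj α x := by
  have h1 : (1 : ℝ) ≤ inner ℝ b y := hy
  have hx' : Matrix.toEuclideanLin A x = b := hx
  rw [← hx', inner_toEuclideanLin, real_inner_comm] at h1
  exact h1.trans (inner_le_polarGauge_mul hα _ x)

theorem exists_isOptimal_dualObj (hα : 0 < α) (hfeas : (primalFeasible A b).Nonempty)
    (hb : b ≠ 0) : ∃ y, IsOptimal (dualObj A α) (dualFeasible b) y := by
  obtain ⟨x, hx⟩ := hfeas
  have hx : Matrix.toEuclideanLin A x = b := hx
  -- The dual objective need not be coercive in `y`, since `A*` may have a kernel. Minimise instead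
  -- over `w = A* y`, where `κ` is coercive; the constraint becomes `⟨x, w⟩ ≥ 1` because `A x = b`.
  let W : Set (EuclideanSpace ℝ (Fin n)) :=
    (LinearMap.range (Matrix.toEuclideanLin A.transpose) : Set _) ∩ {w | 1 ≤ inner ℝ x w}
  have hWc : IsClosed W := (Submodule.closed_of_finiteDimensional _).inter
    (isClosed_le continuous_const (by fun_prop))
  have hmem : ∀ y, y ∈ dualFeasible b → Matrix.toEuclideanLin A.transpose y ∈ W := fun y hy =>
    ⟨⟨y, rfl⟩, by
      change 1 ≤ inner ℝ x _
      rw [← inner_toEuclideanLin, hx]; exact hy⟩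
  have hy₀ : (‖b‖ ^ 2)⁻¹ • b ∈ dualFeasible b := by
    have : ‖b‖ ≠ 0 := norm_ne_zero_iff.2 hb
    change 1 ≤ inner ℝ b _
    rw [inner_smul_right, real_inner_self_eq_norm_sq, inv_mul_cancel₀ (by positivity)]
  have hcoer : Filter.Tendsto (polarGauge α : EuclideanSpace ℝ (Fin n) → ℝ)
      (Filter.cocompact _) Filter.atTop := by
    have h : Filter.Tendsto (fun w : EuclideanSpace ℝ (Fin n) => (n + α) * polarGauge α w)
        (Filter.cocompact _) Filter.atTop :=
      Filter.tendsto_atTop_mono (norm_le_mul_polarGauge hα) tendsto_norm_cocompact_atTop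
    exact (Filter.tendsto_const_mul_atTop_of_pos (by positivity)).1 h
  obtain ⟨w, ⟨⟨y, rfl⟩, hyW⟩, hw⟩ := (continuous_polarGauge hα).continuousOn.exists_isMinOn' hWc
    (hmem _ hy₀) (Filter.Eventually.filter_mono inf_le_left (hcoer.eventually_ge_atTop _))
  refine ⟨y, ?_, fun z hz => hw (hmem z hz)⟩
  have hyW : (1 : ℝ) ≤ inner ℝ x _ := hyW
  rw [← inner_toEuclideanLin, hx] at hyW
  exact hyW

theorem toEuclideanLin_polarGrad_of_isOptimal (hα : 0 < α)
    (hfeas : (primalFeasible A b).Nonempty) {y : EuclideanSpace ℝ (Fin m)}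
    (hy : IsOptimal (dualObj A α) (dualFeasible b) y) :
    Matrix.toEuclideanLin A (polarGrad α (Matrix.toEuclideanLin A.transpose y)) =
      dualObj A α y • b := by
  have hy1 : (1 : ℝ) ≤ inner ℝ b y := hy.1
  set r := dualObj A α y with hr
  have hr0 : 0 ≤ r := polarGauge_nonneg α _
  -- Rescaling `z` to `⟨b, z⟩ = 1` makes it feasible, so homogeneity shows the function is
  -- nonnegative near `y`; at `y` it is at most `0`. Thus `r` acts as the Lagrange multiplier.
  have hmin : IsLocalMin (fun z => dualObj A α z - r * inner ℝ b z) y := by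
    have hopen : IsOpen {z : EuclideanSpace ℝ (Fin m) | (0 : ℝ) < inner ℝ b z} :=
      isOpen_lt continuous_const (by fun_prop)
    filter_upwards [hopen.mem_nhds (show (0 : ℝ) < inner ℝ b y by linarith)] with z hz
    have hz : (0 : ℝ) < inner ℝ b z := hz
    have h1 : (inner ℝ b z)⁻¹ • z ∈ dualFeasible b := by
      change 1 ≤ inner ℝ b _
      rw [inner_smul_right, inv_mul_cancel₀ hz.ne']
    have h2 : r ≤ (inner ℝ b z)⁻¹ * dualObj A α z := by
      refine (hy.2 _ h1).trans ?_
      unfold dualObj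
      rw [map_smul]
      exact polarGauge_smul_le hα (inv_pos.2 hz).le _
    have h3 : r * inner ℝ b z ≤ dualObj A α z := by
      rwa [inv_mul_eq_div, le_div_iff₀ hz] at h2
    have h4 : r ≤ r * inner ℝ b y := le_mul_of_one_le_right hr0 hy1
    linarith
  have hd := (hasGradientAt_dualObj A hα
    (transpose_ne_zero_of_mem_dualFeasible hfeas hy.1)).hasFDerivAt.sub
    (((innerSL ℝ b).hasFDerivAt (x := y)).const_mul r)
  have h0 := hmin.hasFDerivAt_eq_zero hd
  refine ext_inner_right ℝ fun v => ?_
  have := DFunLike.congr_fun h0 v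
  simp only [_root_.sub_apply, _root_.smul_apply,
    _root_.zero_apply, innerSL_apply_apply, InnerProductSpace.toDual_apply_apply,
    smul_eq_mul] at this
  rw [real_inner_smul_left]
  linarith

theorem isOptimal_primal_of_isOptimal_dual (hα : 0 < α)
    (hfeas : (primalFeasible A b).Nonempty) {y : EuclideanSpace ℝ (Fin m)}
    (hy : IsOptimal (dualObj A α) (dualFeasible b) y) :
    IsOptimal (primalObj α) (primalFeasible A b)
        ((dualObj A α y)⁻¹ • polarGrad α (Matrix.toEuclideanLin A.transpose y)) ∧
      primalObj α ((dualObj A α y)⁻¹ • polarGrad α (Matrix.toEuclideanLin A.transpose y)) =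
        (dualObj A α y)⁻¹ := by
  have hw := transpose_ne_zero_of_mem_dualFeasible hfeas hy.1
  have hr : 0 < dualObj A α y := polarGauge_pos hα hw
  have hval : primalObj α ((dualObj A α y)⁻¹ •
      polarGrad α (Matrix.toEuclideanLin A.transpose y)) = (dualObj A α y)⁻¹ := by
    rw [primalObj_smul, primalObj_polarGrad hα hw, mul_one, abs_of_pos (inv_pos.2 hr)]
  refine ⟨⟨?_, fun x hx => ?_⟩, hval⟩
  · change Matrix.toEuclideanLin A _ = b
    rw [map_smul, toEuclideanLin_polarGrad_of_isOptimal hα hfeas hy, inv_smul_smul₀ hr.ne']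
  · rw [hval, inv_le_iff_one_le_mul₀' hr]
    exact one_le_dualObj_mul_primalObj hα hx hy.1

end GaugeDual

end PolarBP

theorem mainTheorem10 {m n : ℕ} (A : Matrix (Fin m) (Fin n) ℝ) (b : EuclideanSpace ℝ (Fin m))
    (α : ℝ) (hα : 0 < α) (hfeas : (PolarBP.primalFeasible A b).Nonempty) (hb : b ≠ 0) :
    -- (i) the optimal values are finite, positive, attained and reciprocal
    (∃ p d : ℝ, PolarBP.IsAttainedValue (PolarBP.primalObj α) (PolarBP.primalFeasible A b) p ∧
      PolarBP.IsAttainedValue (PolarBP.dualObj A α) (PolarBP.dualFeasible b) d ∧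
      0 < p ∧ 0 < d ∧ p = 1 / d) ∧
    -- (ii) the dual objective is differentiable, with locally Lipschitz gradient, on an open
    -- neighbourhood of the dual feasible set
    (∃ U : Set (EuclideanSpace ℝ (Fin m)), IsOpen U ∧ PolarBP.dualFeasible b ⊆ U ∧
      DifferentiableOn ℝ (PolarBP.dualObj A α) U ∧
      LocallyLipschitzOn U (gradient (PolarBP.dualObj A α))) ∧
    -- (iii) recovery of a primal solution from a dual solution
    (∀ (y : EuclideanSpace ℝ (Fin m)) (r : ℝ),
      PolarBP.IsOptimal (PolarBP.dualObj A α) (PolarBP.dualFeasible b) y →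
      r = PolarBP.dualObj A α y →
      ∃ p : EuclideanSpace ℝ (Fin n),
        PolarBP.prox (fun z => r * PolarBP.l1Norm z)
          (Matrix.toEuclideanLin A.transpose y) = {p} ∧
        p = PolarBP.softThreshold r (Matrix.toEuclideanLin A.transpose y) ∧
        p ≠ 0 ∧
        PolarBP.IsOptimal (PolarBP.primalObj α) (PolarBP.primalFeasible A b)
          (((1 / r) / (PolarBP.l1Norm p + α * ‖p‖)) • p)) := by
  obtain ⟨y₀, hy₀⟩ := PolarBP.exists_isOptimal_dualObj hα hfeas hb
  refine ⟨?_, ?_, ?_⟩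
  · obtain ⟨hopt, hval⟩ := PolarBP.isOptimal_primal_of_isOptimal_dual hα hfeas hy₀
    have hr : 0 < PolarBP.dualObj A α y₀ := PolarBP.polarGauge_pos hα
      (PolarBP.transpose_ne_zero_of_mem_dualFeasible hfeas hy₀.1)
    refine ⟨(PolarBP.dualObj A α y₀)⁻¹, PolarBP.dualObj A α y₀, ⟨⟨_, hopt.1, hval⟩, ?_⟩,
      ⟨⟨y₀, hy₀.1, rfl⟩, ?_⟩, inv_pos.2 hr, hr, (one_div _).symm⟩
    · rintro _ ⟨x, hx, rfl⟩
      exact hval.symm.trans_le (hopt.2 x hx)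
    · rintro _ ⟨z, hz, rfl⟩
      exact hy₀.2 z hz
  · refine ⟨{y | Matrix.toEuclideanLin A.transpose y ≠ 0}, ?_,
      fun y hy => PolarBP.transpose_ne_zero_of_mem_dualFeasible hfeas hy,
      fun y hy => (PolarBP.hasGradientAt_dualObj A hα
        hy).hasFDerivAt.differentiableAt.differentiableWithinAt,
      PolarBP.locallyLipschitzOn_gradient_dualObj A hα⟩
    exact isOpen_ne.preimage (LinearMap.continuous_of_finiteDimensional
      (Matrix.toEuclideanLin A.transpose))
  · rintro y r hy rfl
    have hw := PolarBP.transpose_ne_zero_of_mem_dualFeasible hfeas hy.1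
    refine ⟨_, PolarBP.prox_smul_l1Norm (PolarBP.polarGauge_nonneg α _) _, rfl,
      PolarBP.shrink_ne_zero hα hw, ?_⟩
    have h := (PolarBP.isOptimal_primal_of_isOptimal_dual hα hfeas hy).1
    -- `shrink` is by definition the soft threshold at level `r`, so only the scalar factors need
    -- matching.
    rw [PolarBP.polarGrad, smul_smul] at h
    rw [one_div, div_eq_mul_inv]
    exact h
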